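/- Let $n\ge 0$. A (small) strict $n$-category consists of sets $C_k$ of $k$-cells for $0\le k\le n$ with, for all $j<k$, source and target maps $s_j,t_j:C_k\to C_j$, identity maps $C_j\to C_k$, and compositions $x\circ_j y$ of $k$-cells, defined precisely when $s_j(x)=t_j(y)$, such that: for $i<j$ the globular identities $s_is_j=s_it_j=s_i$ and $t_is_j=t_it_j=t_i$ hold; identities can be iterated, and the $j$-source and $j$-target of the identity on a $j$-cell $x$ are $x$; $s_j(x\circ_j y)=s_j(y)$, $t_j(x\circ_j y)=t_j(x)$, and $s_j(x\circ_i y)=s_j(x)\circ_i s_j(y)$, $t_j(x\circ_i y)=t_j(x)\circ_i t_j(y)$ for $i<j$; each $\circ_j$ is associative with identities as units; for $i<j$, the identity on $x\circ_i y$ is the $\circ_i$-composite of the identities on the $j$-cells $x$ and $y$, and $(w\circ_j x)\circ_i(y\circ_j z)=(w\circ_i y)\circ_j(x\circ_i z)$ whenever $w\circ_jx$, $y\circ_jz$ and their $\circ_i$-composite are defined. Strict $n$-functors are families of maps $C_k\to D_k$ preserving all this structure. A catoid $(C,\odot,s,t)$ is a set $C$ with $\odot:C\times C\to\mathcal P(C)$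 and $s,t:C\to C$ such that $\{x\}\odot(y\odot z)=(x\odot y)\odot\{z\}$, $x\odot y\ne\emptyset\Rightarrow s(x)=t(y)$, $x\odot s(x)=\{x\}$ and $t(x)\odot x=\{x\}$, where $X\odot Y=\bigcup_{x\in X,y\in Y}x\odot y$. It is functional if each $y\odot z$ has at most one element, and local if $s(x)=t(y)$ implies $x\odot y\neq\emptyset$. An $n$-catoid consists of $n$ catoid structures $(\odot_i,s_i,t_i)_{0\le i<n}$ on one set such that: for $i\ne j$, each of $s_i,t_i$ commutes with each of $s_j,t_j$, and $s_i(x\odot_jy)\subseteq s_i(x)\odot_js_i(y)$, $t_i(x\odot_jy)\subseteq t_i(x)\odot_jt_i(y)$; and for $i<j$, $(w\odot_jx)\odot_i(y\odot_jz)\subseteq(w\odot_iy)\odot_j(x\odot_iz)$, $s_js_i=s_i=t_js_i$, $s_jt_i=t_i=t_jt_i$, and $s_j(s_j(x)\odot_is_j(y))=s_j(x)\odot_is_j(y)$. It is local (functional) if each of its $n$ catoids is. A morphism of $n$-catoids is a function $f$ commuting with all $s_i$, $t_i$ and satisfying $f(x\odot_iy)\subseteq f(x)\odot_if(y)$ for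 all $i$. **Theorem.** The category of small strict $n$-categories and strict $n$-functors is equivalent to the category of local functional $n$-catoids (as a full subcategory of the category of $n$-catoids). More precisely, there is an equivalence that sends a strict $n$-category, up to a natural bijection, to its set of $n$-cells, where $s_i(x)$ and $t_i(x)$ are the identity $n$-cells on the $i$-dimensional source and target of $x$, and $x\odot_iy$ is $\{x\circ_iy\}$ if this composite is defined and $\emptyset$ otherwise. -/

import Mathlib

open CategoryTheory

universe u

/-! ## Strict `n`-categories (globular definition) -/

/-- A (small) strict `n`-category.  There is a set `cell k` of `k`-cells for every `0 ≤ k ≤ n`.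
For `j < k`, a `k`-cell `x` has an (iterated) `j`-dimensional source `src x` and target `tgt x`,
a `j`-cell `x` has an (iterated) identity `k`-cell `idn x`, and two `k`-cells `x`, `y` have a
composite `x ∘_j y` along `j`-cells, which is defined precisely when the `j`-source of `x` is
the `j`-target of `y`.

In the laws `comp_src`, `comp_tgt`, `idn_comp`, `assoc`, `interchange`, some of the composability
hypotheses are consequences of the others and of the other laws; they are listed only in order
to make the composites in the equations expressions. -/
structure StrictNCat (n : ℕ) : Type (u + 1) where
  /-- the set of `k`-cells, `0 ≤ k ≤ n` -/
  cell : Fin (n + 1) → Type u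
  /-- the `j`-source of a `k`-cell, `j < k` -/
  src : ∀ {j k : Fin (n + 1)}, j < k → cell k → cell j
  /-- the `j`-target of a `k`-cell, `j < k` -/
  tgt : ∀ {j k : Fin (n + 1)}, j < k → cell k → cell j
  /-- the identity `k`-cell on a `j`-cell, `j < k` -/
  idn : ∀ {j k : Fin (n + 1)}, j < k → cell j → cell k
  /-- the composite `x ∘_j y` of `k`-cells, `j < k` -/
  comp : ∀ {j k : Fin (n + 1)} (h : j < k) (x y : cell k), src h x = tgt h y → cell k
  -- globular set
  src_src : ∀ {i j k : Fin (n + 1)} (hij : i < j) (hjk : j < k) (x : cell k),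
    src hij (src hjk x) = src (hij.trans hjk) x
  src_tgt : ∀ {i j k : Fin (n + 1)} (hij : i < j) (hjk : j < k) (x : cell k),
    src hij (tgt hjk x) = src (hij.trans hjk) x
  tgt_src : ∀ {i j k : Fin (n + 1)} (hij : i < j) (hjk : j < k) (x : cell k),
    tgt hij (src hjk x) = tgt (hij.trans hjk) x
  tgt_tgt : ∀ {i j k : Fin (n + 1)} (hij : i < j) (hjk : j < k) (x : cell k),
    tgt hij (tgt hjk x) = tgt (hij.trans hjk) x
  -- identities: iteration, source and target
  idn_idn : ∀ {i j k : Fin (n + 1)} (hij : i < j) (hjk : j < k) (x : cell i),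
    idn hjk (idn hij x) = idn (hij.trans hjk) x
  src_idn : ∀ {j k : Fin (n + 1)} (h : j < k) (x : cell j), src h (idn h x) = x
  tgt_idn : ∀ {j k : Fin (n + 1)} (h : j < k) (x : cell j), tgt h (idn h x) = x
  -- source and target of a composite
  src_comp : ∀ {j k : Fin (n + 1)} (h : j < k) (x y : cell k) (hxy : src h x = tgt h y),
    src h (comp h x y hxy) = src h y
  tgt_comp : ∀ {j k : Fin (n + 1)} (h : j < k) (x y : cell k) (hxy : src h x = tgt h y),
    tgt h (comp h x y hxy) = tgt h x
  comp_src : ∀ {i j k : Fin (n + 1)} (hij : i < j) (hjk : j < k) (x y : cell k)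
    (hxy : src (hij.trans hjk) x = tgt (hij.trans hjk) y)
    (hs : src hij (src hjk x) = tgt hij (src hjk y)),
    src hjk (comp (hij.trans hjk) x y hxy) = comp hij (src hjk x) (src hjk y) hs
  comp_tgt : ∀ {i j k : Fin (n + 1)} (hij : i < j) (hjk : j < k) (x y : cell k)
    (hxy : src (hij.trans hjk) x = tgt (hij.trans hjk) y)
    (ht : src hij (tgt hjk x) = tgt hij (tgt hjk y)),
    tgt hjk (comp (hij.trans hjk) x y hxy) = comp hij (tgt hjk x) (tgt hjk y) ht
  -- unit laws and associativity
  idn_tgt_comp : ∀ {j k : Fin (n + 1)} (h : j < k) (x : cell k),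
    comp h (idn h (tgt h x)) x (src_idn h _) = x
  comp_idn_src : ∀ {j k : Fin (n + 1)} (h : j < k) (x : cell k),
    comp h x (idn h (src h x)) (tgt_idn h _).symm = x
  assoc : ∀ {j k : Fin (n + 1)} (h : j < k) (x y z : cell k)
    (hxy : src h x = tgt h y) (hyz : src h y = tgt h z)
    (h₁ : src h (comp h x y hxy) = tgt h z) (h₂ : src h x = tgt h (comp h y z hyz)),
    comp h (comp h x y hxy) z h₁ = comp h x (comp h y z hyz) h₂
  -- functoriality of identities and the interchange law
  idn_comp : ∀ {i j k : Fin (n + 1)} (hij : i < j) (hjk : j < k) (x y : cell j)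
    (hxy : src hij x = tgt hij y)
    (h : src (hij.trans hjk) (idn hjk x) = tgt (hij.trans hjk) (idn hjk y)),
    idn hjk (comp hij x y hxy) = comp (hij.trans hjk) (idn hjk x) (idn hjk y) h
  interchange : ∀ {i j k : Fin (n + 1)} (hij : i < j) (hjk : j < k) (w x y z : cell k)
    (hwx : src hjk w = tgt hjk x) (hyz : src hjk y = tgt hjk z)
    (hwy : src (hij.trans hjk) w = tgt (hij.trans hjk) y)
    (hxz : src (hij.trans hjk) x = tgt (hij.trans hjk) z)
    (h₁ : src (hij.trans hjk) (comp hjk w x hwx) = tgt (hij.trans hjk) (comp hjk y z hyz))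
    (h₂ : src hjk (comp (hij.trans hjk) w y hwy) = tgt hjk (comp (hij.trans hjk) x z hxz)),
    comp (hij.trans hjk) (comp hjk w x hwx) (comp hjk y z hyz) h₁ =
      comp hjk (comp (hij.trans hjk) w y hwy) (comp (hij.trans hjk) x z hxz) h₂

namespace StrictNCat

variable {n : ℕ}

/-- A strict `n`-functor: maps on `k`-cells for all `k`, preserving all of the structure. -/
@[ext]
structure Hom (C D : StrictNCat.{u} n) : Type u where
  map : ∀ k : Fin (n + 1), C.cell k → D.cell k
  map_src : ∀ {j k : Fin (n + 1)} (h : j < k) (x : C.cell k),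
    map j (C.src h x) = D.src h (map k x)
  map_tgt : ∀ {j k : Fin (n + 1)} (h : j < k) (x : C.cell k),
    map j (C.tgt h x) = D.tgt h (map k x)
  map_idn : ∀ {j k : Fin (n + 1)} (h : j < k) (x : C.cell j),
    map k (C.idn h x) = D.idn h (map j x)
  map_comp : ∀ {j k : Fin (n + 1)} (h : j < k) (x y : C.cell k)
    (hxy : C.src h x = C.tgt h y) (hxy' : D.src h (map k x) = D.tgt h (map k y)),
    map k (C.comp h x y hxy) = D.comp h (map k x) (map k y) hxy'

/-- The category of small strict `n`-categories and strict `n`-functors. -/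
instance : Category.{u} (StrictNCat.{u} n) where
  Hom := Hom
  id C :=
    { map := fun _ x => x
      map_src := fun _ _ => rfl
      map_tgt := fun _ _ => rfl
      map_idn := fun _ _ => rfl
      map_comp := fun _ _ _ _ _ => rfl }
  comp {C D E} F G :=
    { map := fun k x => G.map k (F.map k x)
      map_src := fun h x => by rw [F.map_src, G.map_src]
      map_tgt := fun h x => by rw [F.map_tgt, G.map_tgt]
      map_idn := fun h x => by rw [F.map_idn, G.map_idn]
      map_comp := fun h x y hxy hxy' => by
        have hF : D.src h (F.map _ x) = D.tgt h (F.map _ y) := by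
          rw [← F.map_src, ← F.map_tgt, hxy]
        rw [F.map_comp h x y hxy hF, G.map_comp h _ _ hF hxy'] }

/-- The action of a strict `n`-functor on `k`-cells. -/
def onCells {C D : StrictNCat.{u} n} (F : C ⟶ D) (k : Fin (n + 1)) : C.cell k → D.cell k :=
  Hom.map F k

end StrictNCat

/-! ## Catoids and `n`-catoids -/

/-- A catoid structure `(C, ⊙, s, t)` on the set `C`. -/
structure Catoid (C : Type u) : Type u where
  /-- the multioperation `⊙ : C × C → 𝒫 C` -/
  mul : C → C → Set C
  src : C → C
  tgt : C → C
  assoc : ∀ x y z : C, (⋃ v ∈ mul y z, mul x v) = ⋃ w ∈ mul x y, mul w z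
  src_eq_tgt : ∀ x y : C, (mul x y).Nonempty → src x = tgt y
  mul_src : ∀ x : C, mul x (src x) = {x}
  tgt_mul : ∀ x : C, mul (tgt x) x = {x}

namespace Catoid

variable {C : Type u}

/-- The extension of the multioperation to subsets, `X ⊙ Y = ⋃_{x ∈ X, y ∈ Y} x ⊙ y`. -/
def setMul (K : Catoid C) (X Y : Set C) : Set C :=
  ⋃ x ∈ X, ⋃ y ∈ Y, K.mul x y

/-- A catoid is functional if each `y ⊙ z` has at most one element. -/
def IsFunctional (K : Catoid C) : Prop :=
  ∀ x x' y z : C, x ∈ K.mul y z → x' ∈ K.mul y z → x = x'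

/-- A catoid is local if `x ⊙ y` is non-empty whenever the source of `x` is the target of `y`. -/
def IsLocal (K : Catoid C) : Prop :=
  ∀ x y : C, K.src x = K.tgt y → (K.mul x y).Nonempty

end Catoid

/-- An `n`-catoid: a set with `n` interacting catoid structures. -/
structure NCatoid (n : ℕ) : Type (u + 1) where
  carrier : Type u
  /-- the catoid structure `(⊙_i, s_i, t_i)`, `0 ≤ i < n` -/
  str : Fin n → Catoid carrier
  src_src_comm : ∀ i j, i ≠ j → ∀ x, (str i).src ((str j).src x) = (str j).src ((str i).src x)
  src_tgt_comm : ∀ i j, i ≠ j → ∀ x, (str i).src ((str j).tgt x) = (str j).tgt ((str i).src x)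
  tgt_src_comm : ∀ i j, i ≠ j → ∀ x, (str i).tgt ((str j).src x) = (str j).src ((str i).tgt x)
  tgt_tgt_comm : ∀ i j, i ≠ j → ∀ x, (str i).tgt ((str j).tgt x) = (str j).tgt ((str i).tgt x)
  src_mul_subset : ∀ i j, i ≠ j → ∀ x y,
    (str i).src '' (str j).mul x y ⊆ (str j).mul ((str i).src x) ((str i).src y)
  tgt_mul_subset : ∀ i j, i ≠ j → ∀ x y,
    (str i).tgt '' (str j).mul x y ⊆ (str j).mul ((str i).tgt x) ((str i).tgt y)
  interchange : ∀ i j, i < j → ∀ w x y z,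
    (str i).setMul ((str j).mul w x) ((str j).mul y z) ⊆
      (str j).setMul ((str i).mul w y) ((str i).mul x z)
  src_src : ∀ i j, i < j → ∀ x, (str j).src ((str i).src x) = (str i).src x
  src_tgt : ∀ i j, i < j → ∀ x, (str j).src ((str i).tgt x) = (str i).tgt x
  tgt_src : ∀ i j, i < j → ∀ x, (str j).tgt ((str i).src x) = (str i).src x
  tgt_tgt : ∀ i j, i < j → ∀ x, (str j).tgt ((str i).tgt x) = (str i).tgt x
  closure : ∀ i j, i < j → ∀ x y,
    (str j).src '' (str i).mul ((str j).src x) ((str j).src y) =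
      (str i).mul ((str j).src x) ((str j).src y)

namespace NCatoid

variable {n : ℕ}

/-- A morphism of `n`-catoids: a function that commutes with all source and target maps and
satisfies `f (x ⊙_i y) ⊆ f x ⊙_i f y` for all `i`. -/
@[ext]
structure Hom (C D : NCatoid.{u} n) : Type u where
  toFun : C.carrier → D.carrier
  map_src : ∀ i x, toFun ((C.str i).src x) = (D.str i).src (toFun x)
  map_tgt : ∀ i x, toFun ((C.str i).tgt x) = (D.str i).tgt (toFun x)
  map_mul : ∀ i x y, toFun '' (C.str i).mul x y ⊆ (D.str i).mul (toFun x) (toFun y)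

/-- The category of `n`-catoids. -/
instance : Category.{u} (NCatoid.{u} n) where
  Hom := Hom
  id C :=
    { toFun := fun x => x
      map_src := fun _ _ => rfl
      map_tgt := fun _ _ => rfl
      map_mul := fun i x y => by simp }
  comp {C D E} f g :=
    { toFun := fun x => g.toFun (f.toFun x)
      map_src := fun i x => by rw [f.map_src, g.map_src]
      map_tgt := fun i x => by rw [f.map_tgt, g.map_tgt]
      map_mul := fun i x y => by
        rintro _ ⟨z, hz, rfl⟩
        exact g.map_mul i _ _ ⟨_, f.map_mul i x y ⟨z, hz, rfl⟩, rfl⟩ }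

/-- The function underlying a morphism of `n`-catoids. -/
def fn {C D : NCatoid.{u} n} (f : C ⟶ D) : C.carrier → D.carrier :=
  Hom.toFun f

/-- An `n`-catoid is local if each of its `n` catoids is local, and functional if each of them
is functional. -/
def isLocalFunctional (n : ℕ) : ObjectProperty (NCatoid.{u} n) := fun C =>
  (∀ i, (C.str i).IsLocal) ∧ ∀ i, (C.str i).IsFunctional

end NCatoid

/-- The category of local functional `n`-catoids, as a full subcategory of that of `n`-catoids. -/
abbrev LocalFunctionalNCatoid (n : ℕ) : Type (u + 1) :=
  (NCatoid.isLocalFunctional.{u} n).FullSubcategory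

/-! ## Catoids -/

namespace Catoid

variable {C : Type u} (K : Catoid C)

/-! A strict `n`-category is determined by its `n`-cells. Iterated identities embed the `k`-cells in
the `n`-cells, with the `k`-source as a retraction; for `k < n` the image is the fixed-point set of
`s_k` (`topIdn_injective`, `topIdn_topSrc`). Under this embedding identities become inclusions, and
sources, targets and composites become `s_j`, `t_j` and `⊙_j`. Hence a strict `n`-functor is
determined by its action on `n`-cells. Conversely, a morphism of the `n`-catoids preserves the fixed
points of each `s_k`, so it restricts to cells of every dimension (`homOfNCatoidHom`): `toNCatoid`
is fully faithful.

For essential surjectivity, the `k`-cells of a local functional `n`-catoid are taken to be the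
common fixed points of the `s_i` with `i ≥ k`. Locality makes composites exist exactly when source
and target match. Functionality makes them unique, so that each inclusion axiom becomes an equation
(`eq_mulElem`). The closure axiom keeps composites of `k`-cells among the `k`-cells
(`src_of_mem_mul_of_fixed`). In dimension `n` the fixed-point condition is empty, which returns the
original `n`-catoid (`isoNCatoid`). -/

theorem tgt_src_self (x : C) : K.tgt (K.src x) = K.src x :=
  (K.src_eq_tgt x (K.src x) (by simp [K.mul_src])).symm

theorem src_tgt_self (x : C) : K.src (K.tgt x) = K.tgt x :=
  K.src_eq_tgt (K.tgt x) x (by simp [K.tgt_mul])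

theorem src_src_self (x : C) : K.src (K.src x) = K.src x := by
  rw [← K.tgt_src_self x, K.src_tgt_self]

variable {K} {x y z : C}

theorem tgt_eq_self_of_src_eq_self (h : K.src x = x) : K.tgt x = x := by
  rw [← h, K.tgt_src_self]

/-- Neither locality nor functionality is needed: `z` lies in `(x ⊙ y) ⊙ s(z)`, so by associativity
`y ⊙ s(z)` is non-empty and `s(y) = t(s(z)) = s(z)`. -/
theorem src_of_mem_mul (hz : z ∈ K.mul x y) : K.src z = K.src y := by
  have h : z ∈ ⋃ w ∈ K.mul x y, K.mul w (K.src z) :=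
    Set.mem_biUnion hz (by simp [K.mul_src])
  rw [← K.assoc] at h
  obtain ⟨v, hv, -⟩ := Set.mem_iUnion₂.1 h
  rw [K.src_eq_tgt _ _ ⟨v, hv⟩, K.tgt_src_self]

theorem tgt_of_mem_mul (hz : z ∈ K.mul x y) : K.tgt z = K.tgt x := by
  have h : z ∈ ⋃ w ∈ K.mul x y, K.mul (K.tgt z) w :=
    Set.mem_biUnion hz (by simp [K.tgt_mul])
  rw [K.assoc] at h
  obtain ⟨v, hv, -⟩ := Set.mem_iUnion₂.1 h
  rw [← K.src_eq_tgt _ _ ⟨v, hv⟩, K.src_tgt_self]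

end Catoid

/-! ## The `n`-catoid of `n`-cells of a strict `n`-category -/

namespace StrictNCat

variable {n : ℕ}

theorem comp_congr (C : StrictNCat.{u} n) {j k : Fin (n + 1)} (h : j < k) {x x' y y' : C.cell k}
    (hx : x = x') (hy : y = y') (hxy : C.src h x = C.tgt h y) (hxy' : C.src h x' = C.tgt h y') :
    C.comp h x y hxy = C.comp h x' y' hxy' := by
  subst hx hy; rfl

theorem comp_idn_idn (C : StrictNCat.{u} n) {j k : Fin (n + 1)} (h : j < k) (a : C.cell j)
    (hxy : C.src h (C.idn h a) = C.tgt h (C.idn h a)) :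
    C.comp h (C.idn h a) (C.idn h a) hxy = C.idn h a := by
  rw [C.comp_congr h rfl (congrArg (C.idn h) (C.src_idn h a).symm) _ (C.tgt_idn h _).symm,
    C.comp_idn_src]

section

variable (C : StrictNCat.{u} n) {i j k : Fin (n + 1)} (hij : i < j) (hjk : j < k)

theorem src_idn_of_lt (x : C.cell j) :
    C.src (hij.trans hjk) (C.idn hjk x) = C.src hij x := by
  rw [← C.src_src hij hjk, C.src_idn]

theorem tgt_idn_of_lt (x : C.cell j) :
    C.tgt (hij.trans hjk) (C.idn hjk x) = C.tgt hij x := by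
  rw [← C.tgt_tgt hij hjk, C.tgt_idn]

theorem src_idn_of_gt (x : C.cell i) :
    C.src hjk (C.idn (hij.trans hjk) x) = C.idn hij x := by
  rw [← C.idn_idn hij hjk, C.src_idn]

theorem tgt_idn_of_gt (x : C.cell i) :
    C.tgt hjk (C.idn (hij.trans hjk) x) = C.idn hij x := by
  rw [← C.idn_idn hij hjk, C.tgt_idn]

theorem src_comp_of_lt (x y : C.cell k) (hxy : C.src hjk x = C.tgt hjk y) :
    C.src (hij.trans hjk) (C.comp hjk x y hxy) = C.src (hij.trans hjk) y := by
  rw [← C.src_src hij hjk, C.src_comp, C.src_src]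

theorem tgt_comp_of_lt (x y : C.cell k) (hxy : C.src hjk x = C.tgt hjk y) :
    C.tgt (hij.trans hjk) (C.comp hjk x y hxy) = C.tgt (hij.trans hjk) x := by
  rw [← C.tgt_tgt hij hjk, C.tgt_comp, C.tgt_tgt]

variable {C} in
theorem src_eq_src_of_composable {x y : C.cell k} (hxy : C.src hjk x = C.tgt hjk y) :
    C.src (hij.trans hjk) x = C.src (hij.trans hjk) y := by
  rw [← C.src_src hij hjk, hxy, C.src_tgt]

variable {C} in
theorem tgt_eq_tgt_of_composable {x y : C.cell k} (hxy : C.src hjk x = C.tgt hjk y) :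
    C.tgt (hij.trans hjk) x = C.tgt (hij.trans hjk) y := by
  rw [← C.tgt_src hij hjk, hxy, C.tgt_tgt]

variable {C} in
theorem src_composable {x y : C.cell k}
    (hxy : C.src (hij.trans hjk) x = C.tgt (hij.trans hjk) y) :
    C.src hij (C.src hjk x) = C.tgt hij (C.src hjk y) := by
  rw [C.src_src, C.tgt_src, hxy]

variable {C} in
theorem tgt_composable {x y : C.cell k}
    (hxy : C.src (hij.trans hjk) x = C.tgt (hij.trans hjk) y) :
    C.src hij (C.tgt hjk x) = C.tgt hij (C.tgt hjk y) := by
  rw [C.src_tgt, C.tgt_tgt, hxy]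

end

/-- The catoid of `k`-cells of a strict `n`-category under composition along `j`-cells. -/
def catoid (C : StrictNCat.{u} n) {j k : Fin (n + 1)} (h : j < k) : Catoid (C.cell k) where
  mul x y := {z | ∃ hxy : C.src h x = C.tgt h y, z = C.comp h x y hxy}
  src x := C.idn h (C.src h x)
  tgt x := C.idn h (C.tgt h x)
  assoc x y z := by
    ext a
    simp only [Set.mem_iUnion, Set.mem_ofPred_eq, exists_prop]
    constructor
    · rintro ⟨_, ⟨hyz, rfl⟩, hx, rfl⟩
      have hxy : C.src h x = C.tgt h y := by rw [hx, C.tgt_comp]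
      exact ⟨_, ⟨hxy, rfl⟩, by rw [C.src_comp, hyz], (C.assoc h x y z hxy hyz _ _).symm⟩
    · rintro ⟨_, ⟨hxy, rfl⟩, hz, rfl⟩
      have hyz : C.src h y = C.tgt h z := by rw [← hz, C.src_comp]
      exact ⟨_, ⟨hyz, rfl⟩, by rw [C.tgt_comp, hxy], C.assoc h x y z hxy hyz _ _⟩
  src_eq_tgt x y := by
    rintro ⟨_, h, -⟩
    rw [h]
  mul_src x := by
    ext a
    constructor
    · rintro ⟨_, rfl⟩
      exact C.comp_idn_src h x
    · rintro rfl
      exact ⟨(C.tgt_idn h _).symm, (C.comp_idn_src h _).symm⟩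
  tgt_mul x := by
    ext a
    constructor
    · rintro ⟨_, rfl⟩
      exact C.idn_tgt_comp h x
    · rintro rfl
      exact ⟨C.src_idn h _, (C.idn_tgt_comp h _).symm⟩

/-! ### Interaction of two compositions -/

section

variable (C : StrictNCat.{u} n) {i j k : Fin (n + 1)} (hij : i < j) (hjk : j < k) (x : C.cell k)

/-- By globularity, a lower source or target does not see a higher one applied before it. As higher
ones also fix lower identities, both orders of application give the lower map, whence the
commutation axioms. -/
theorem catoid_src_low_src_high : (C.catoid (hij.trans hjk)).src ((C.catoid hjk).src x) =
    (C.catoid (hij.trans hjk)).src x := by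
  simp only [catoid]; rw [C.src_idn_of_lt hij hjk, C.src_src]

theorem catoid_src_low_tgt_high : (C.catoid (hij.trans hjk)).src ((C.catoid hjk).tgt x) =
    (C.catoid (hij.trans hjk)).src x := by
  simp only [catoid]; rw [C.src_idn_of_lt hij hjk, C.src_tgt]

theorem catoid_tgt_low_src_high : (C.catoid (hij.trans hjk)).tgt ((C.catoid hjk).src x) =
    (C.catoid (hij.trans hjk)).tgt x := by
  simp only [catoid]; rw [C.tgt_idn_of_lt hij hjk, C.tgt_src]

theorem catoid_tgt_low_tgt_high : (C.catoid (hij.trans hjk)).tgt ((C.catoid hjk).tgt x) =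
    (C.catoid (hij.trans hjk)).tgt x := by
  simp only [catoid]; rw [C.tgt_idn_of_lt hij hjk, C.tgt_tgt]

theorem catoid_src_high_idn_low (a : C.cell i) :
    (C.catoid hjk).src (C.idn (hij.trans hjk) a) = C.idn (hij.trans hjk) a := by
  simp only [catoid]; rw [C.src_idn_of_gt hij hjk, C.idn_idn]

theorem catoid_tgt_high_idn_low (a : C.cell i) :
    (C.catoid hjk).tgt (C.idn (hij.trans hjk) a) = C.idn (hij.trans hjk) a := by
  simp only [catoid]; rw [C.tgt_idn_of_gt hij hjk, C.idn_idn]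

theorem idn_mem_catoid_mul_self (a : C.cell i) :
    C.idn (hij.trans hjk) a ∈
      (C.catoid hjk).mul (C.idn (hij.trans hjk) a) (C.idn (hij.trans hjk) a) := by
  rw [← C.idn_idn hij hjk]
  exact ⟨by rw [C.src_idn, C.tgt_idn], (C.comp_idn_idn hjk _ _).symm⟩

variable (y : C.cell k)

/-- Cells composable along `j` share their `i`-source, so both factors on the right are the same
identity cell, which is idempotent for `∘_j`. -/
theorem catoid_src_low_mul_high_subset :
    (C.catoid (hij.trans hjk)).src '' (C.catoid hjk).mul x y ⊆
      (C.catoid hjk).mul ((C.catoid (hij.trans hjk)).src x)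
        ((C.catoid (hij.trans hjk)).src y) := by
  rintro _ ⟨_, ⟨hxy, rfl⟩, rfl⟩
  simp only [catoid]
  rw [C.src_comp_of_lt hij hjk, src_eq_src_of_composable hij hjk hxy]
  exact C.idn_mem_catoid_mul_self hij hjk _

theorem catoid_tgt_low_mul_high_subset :
    (C.catoid (hij.trans hjk)).tgt '' (C.catoid hjk).mul x y ⊆
      (C.catoid hjk).mul ((C.catoid (hij.trans hjk)).tgt x)
        ((C.catoid (hij.trans hjk)).tgt y) := by
  rintro _ ⟨_, ⟨hxy, rfl⟩, rfl⟩
  simp only [catoid]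
  rw [C.tgt_comp_of_lt hij hjk, tgt_eq_tgt_of_composable hij hjk hxy]
  exact C.idn_mem_catoid_mul_self hij hjk _

theorem idn_comp_mem_catoid_mul (a b : C.cell j) (h : C.src hij a = C.tgt hij b) :
    C.idn hjk (C.comp hij a b h) ∈
      (C.catoid (hij.trans hjk)).mul (C.idn hjk a) (C.idn hjk b) :=
  ⟨by rw [C.src_idn_of_lt hij, C.tgt_idn_of_lt hij, h], C.idn_comp hij hjk a b h _⟩

theorem catoid_src_high_mul_low_subset :
    (C.catoid hjk).src '' (C.catoid (hij.trans hjk)).mul x y ⊆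
      (C.catoid (hij.trans hjk)).mul ((C.catoid hjk).src x) ((C.catoid hjk).src y) := by
  rintro _ ⟨_, ⟨hxy, rfl⟩, rfl⟩
  have h := C.idn_comp_mem_catoid_mul hij hjk _ _ (src_composable hij hjk hxy)
  rwa [← C.comp_src hij hjk x y hxy] at h

theorem catoid_tgt_high_mul_low_subset :
    (C.catoid hjk).tgt '' (C.catoid (hij.trans hjk)).mul x y ⊆
      (C.catoid (hij.trans hjk)).mul ((C.catoid hjk).tgt x) ((C.catoid hjk).tgt y) := by
  rintro _ ⟨_, ⟨hxy, rfl⟩, rfl⟩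
  have h := C.idn_comp_mem_catoid_mul hij hjk _ _ (tgt_composable hij hjk hxy)
  rwa [← C.comp_tgt hij hjk x y hxy] at h

/-- A composite of identities is the identity on a composite, so `s_j` fixes every element of the
product. -/
theorem catoid_closure :
    (C.catoid hjk).src '' (C.catoid (hij.trans hjk)).mul ((C.catoid hjk).src x)
        ((C.catoid hjk).src y) =
      (C.catoid (hij.trans hjk)).mul ((C.catoid hjk).src x) ((C.catoid hjk).src y) := by
  have key : ∀ a ∈ (C.catoid (hij.trans hjk)).mul ((C.catoid hjk).src x) ((C.catoid hjk).src y),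
      (C.catoid hjk).src a = a := by
    rintro _ ⟨h, rfl⟩
    have h' : C.src hij (C.src hjk x) = C.tgt hij (C.src hjk y) := by
      have e := h
      simp only [catoid] at e
      rwa [C.src_idn_of_lt, C.tgt_idn_of_lt] at e
    have e := C.idn_comp hij hjk _ _ h' h
    simp only [catoid]
    rw [← e, C.src_idn]
  rw [Set.image_congr key, Set.image_id']

theorem catoid_interchange (w z : C.cell k) :
    (C.catoid (hij.trans hjk)).setMul ((C.catoid hjk).mul w x) ((C.catoid hjk).mul y z) ⊆
      (C.catoid hjk).setMul ((C.catoid (hij.trans hjk)).mul w y)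
        ((C.catoid (hij.trans hjk)).mul x z) := by
  intro a ha
  simp only [Catoid.setMul, Set.mem_iUnion] at ha ⊢
  obtain ⟨_, ⟨hwx, rfl⟩, _, ⟨hyz, rfl⟩, h, rfl⟩ := ha
  -- Composability of the outer composite only says that the `i`-source of `x` is the `i`-target of
  -- `y`. The other conditions follow because `w`, `x` share their `i`-source and `y`, `z` their
  -- `i`-target.
  have hxy := h
  rw [C.src_comp_of_lt hij, C.tgt_comp_of_lt hij] at hxy
  have hwy : C.src (hij.trans hjk) w = C.tgt (hij.trans hjk) y := by
    rw [src_eq_src_of_composable hij hjk hwx, hxy]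
  have hxz : C.src (hij.trans hjk) x = C.tgt (hij.trans hjk) z := by
    rw [hxy, tgt_eq_tgt_of_composable hij hjk hyz]
  have h₂ : C.src hjk (C.comp (hij.trans hjk) w y hwy) =
      C.tgt hjk (C.comp (hij.trans hjk) x z hxz) := by
    rw [C.comp_src hij hjk w y hwy (src_composable hij hjk hwy),
      C.comp_tgt hij hjk x z hxz (tgt_composable hij hjk hxz)]
    exact C.comp_congr hij hwx hyz _ _
  exact ⟨_, ⟨hwy, rfl⟩, _, ⟨hxz, rfl⟩, h₂, C.interchange hij hjk w x y z hwx hyz hwy hxz h h₂⟩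

end

/-- The `n`-catoid of `n`-cells of a strict `n`-category. -/
def nCatoid (C : StrictNCat.{u} n) : NCatoid.{u} n where
  carrier := C.cell (Fin.last n)
  str i := C.catoid (Fin.castSucc_lt_last i)
  src_src_comm i j hij x := by
    rcases lt_or_gt_of_ne hij with h | h
    · exact (C.catoid_src_low_src_high (Fin.castSucc_lt_castSucc_iff.2 h) _ x).trans
        (C.catoid_src_high_idn_low (Fin.castSucc_lt_castSucc_iff.2 h) _ _).symm
    · exact (C.catoid_src_high_idn_low (Fin.castSucc_lt_castSucc_iff.2 h) _ _).trans
        (C.catoid_src_low_src_high (Fin.castSucc_lt_castSucc_iff.2 h) _ x).symm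
  src_tgt_comm i j hij x := by
    rcases lt_or_gt_of_ne hij with h | h
    · exact (C.catoid_src_low_tgt_high (Fin.castSucc_lt_castSucc_iff.2 h) _ x).trans
        (C.catoid_tgt_high_idn_low (Fin.castSucc_lt_castSucc_iff.2 h) _ _).symm
    · exact (C.catoid_src_high_idn_low (Fin.castSucc_lt_castSucc_iff.2 h) _ _).trans
        (C.catoid_tgt_low_src_high (Fin.castSucc_lt_castSucc_iff.2 h) _ x).symm
  tgt_src_comm i j hij x := by
    rcases lt_or_gt_of_ne hij with h | h
    · exact (C.catoid_tgt_low_src_high (Fin.castSucc_lt_castSucc_iff.2 h) _ x).trans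
        (C.catoid_src_high_idn_low (Fin.castSucc_lt_castSucc_iff.2 h) _ _).symm
    · exact (C.catoid_tgt_high_idn_low (Fin.castSucc_lt_castSucc_iff.2 h) _ _).trans
        (C.catoid_src_low_tgt_high (Fin.castSucc_lt_castSucc_iff.2 h) _ x).symm
  tgt_tgt_comm i j hij x := by
    rcases lt_or_gt_of_ne hij with h | h
    · exact (C.catoid_tgt_low_tgt_high (Fin.castSucc_lt_castSucc_iff.2 h) _ x).trans
        (C.catoid_tgt_high_idn_low (Fin.castSucc_lt_castSucc_iff.2 h) _ _).symm
    · exact (C.catoid_tgt_high_idn_low (Fin.castSucc_lt_castSucc_iff.2 h) _ _).trans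
        (C.catoid_tgt_low_tgt_high (Fin.castSucc_lt_castSucc_iff.2 h) _ x).symm
  src_mul_subset i j hij x y := by
    rcases lt_or_gt_of_ne hij with h | h
    · exact C.catoid_src_low_mul_high_subset (Fin.castSucc_lt_castSucc_iff.2 h) _ x y
    · exact C.catoid_src_high_mul_low_subset (Fin.castSucc_lt_castSucc_iff.2 h) _ x y
  tgt_mul_subset i j hij x y := by
    rcases lt_or_gt_of_ne hij with h | h
    · exact C.catoid_tgt_low_mul_high_subset (Fin.castSucc_lt_castSucc_iff.2 h) _ x y
    · exact C.catoid_tgt_high_mul_low_subset (Fin.castSucc_lt_castSucc_iff.2 h) _ x y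
  interchange _ _ h w x y z :=
    C.catoid_interchange (Fin.castSucc_lt_castSucc_iff.2 h) _ x y w z
  src_src _ _ h _ := C.catoid_src_high_idn_low (Fin.castSucc_lt_castSucc_iff.2 h) _ _
  src_tgt _ _ h _ := C.catoid_src_high_idn_low (Fin.castSucc_lt_castSucc_iff.2 h) _ _
  tgt_src _ _ h _ := C.catoid_tgt_high_idn_low (Fin.castSucc_lt_castSucc_iff.2 h) _ _
  tgt_tgt _ _ h _ := C.catoid_tgt_high_idn_low (Fin.castSucc_lt_castSucc_iff.2 h) _ _
  closure _ _ h x y := C.catoid_closure (Fin.castSucc_lt_castSucc_iff.2 h) _ x y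

theorem isLocalFunctional_nCatoid (C : StrictNCat.{u} n) :
    NCatoid.isLocalFunctional n C.nCatoid := by
  constructor
  · intro i x y hxy
    -- The hypothesis equates identity `n`-cells; taking `i`-sources recovers the equality of the
    -- underlying `i`-cells.
    have h := congrArg (C.src (Fin.castSucc_lt_last i)) hxy
    simp only [nCatoid, catoid] at h
    rw [C.src_idn, C.src_idn] at h
    exact ⟨_, h, rfl⟩
  · rintro i _ _ y z ⟨_, rfl⟩ ⟨_, rfl⟩
    rfl

section

variable {C D : StrictNCat.{u} n} (F : Hom C D) {j k : Fin (n + 1)} (h : j < k) (x y : C.cell k)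

theorem Hom.map_catoid_src : F.map k ((C.catoid h).src x) = (D.catoid h).src (F.map k x) := by
  simp only [catoid]
  rw [F.map_idn, F.map_src]

theorem Hom.map_catoid_tgt : F.map k ((C.catoid h).tgt x) = (D.catoid h).tgt (F.map k x) := by
  simp only [catoid]
  rw [F.map_idn, F.map_tgt]

theorem Hom.map_catoid_mul :
    F.map k '' (C.catoid h).mul x y ⊆ (D.catoid h).mul (F.map k x) (F.map k y) := by
  rintro _ ⟨_, ⟨hxy, rfl⟩, rfl⟩
  have hxy' := congrArg (F.map _) hxy
  rw [F.map_src, F.map_tgt] at hxy'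
  exact ⟨hxy', F.map_comp _ _ _ hxy hxy'⟩

/-- The morphism of `n`-catoids of `n`-cells induced by a strict `n`-functor. -/
def Hom.nCatoidHom : NCatoid.Hom C.nCatoid D.nCatoid where
  toFun := F.map (Fin.last n)
  map_src _ x := F.map_catoid_src _ x
  map_tgt _ x := F.map_catoid_tgt _ x
  map_mul _ x y := F.map_catoid_mul _ x y

end

/-- The functor sending a strict `n`-category to the `n`-catoid of its `n`-cells. -/
def toNCatoid (n : ℕ) : StrictNCat.{u} n ⥤ LocalFunctionalNCatoid.{u} n where
  obj C := ⟨C.nCatoid, C.isLocalFunctional_nCatoid⟩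
  map F := ObjectProperty.homMk (Hom.nCatoidHom F)

/-! ### Cells of lower dimension as `n`-cells -/

section

variable (C : StrictNCat.{u} n)

/-- The iterated identity `n`-cell on a `k`-cell, `k ≤ n`. -/
def topIdn (k : Fin (n + 1)) (x : C.cell k) : C.cell (Fin.last n) :=
  if h : k < Fin.last n then C.idn h x else (Fin.last_le_iff.1 (not_lt.1 h)) ▸ x

/-- The `k`-source of an `n`-cell, `k ≤ n`. -/
def topSrc (k : Fin (n + 1)) (x : C.cell (Fin.last n)) : C.cell k :=
  if h : k < Fin.last n then C.src h x else (Fin.last_le_iff.1 (not_lt.1 h)).symm ▸ x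

variable {C}

theorem topIdn_of_lt {k : Fin (n + 1)} (h : k < Fin.last n) (x : C.cell k) :
    C.topIdn k x = C.idn h x := dif_pos h

@[simp]
theorem topIdn_last (x : C.cell (Fin.last n)) : C.topIdn (Fin.last n) x = x :=
  dif_neg (lt_irrefl _)

theorem topSrc_of_lt {k : Fin (n + 1)} (h : k < Fin.last n) (x : C.cell (Fin.last n)) :
    C.topSrc k x = C.src h x := dif_pos h

@[simp]
theorem topSrc_last (x : C.cell (Fin.last n)) : C.topSrc (Fin.last n) x = x :=
  dif_neg (lt_irrefl _)

@[simp]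
theorem topSrc_topIdn {k : Fin (n + 1)} (x : C.cell k) : C.topSrc k (C.topIdn k x) = x := by
  obtain rfl | h := eq_or_lt_of_le (Fin.le_last k)
  · simp
  · rw [topIdn_of_lt h, topSrc_of_lt h, C.src_idn]

/-- Reduces equations between cells of any dimension to equations between `n`-cells. -/
theorem topIdn_injective (k : Fin (n + 1)) : Function.Injective (C.topIdn k) :=
  Function.LeftInverse.injective topSrc_topIdn

variable {j k : Fin (n + 1)} (h : j < k)

theorem topIdn_idn (x : C.cell j) : C.topIdn k (C.idn h x) = C.topIdn j x := by
  obtain rfl | hk := eq_or_lt_of_le (Fin.le_last k)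
  · rw [topIdn_of_lt h, topIdn_last]
  · rw [topIdn_of_lt hk, topIdn_of_lt (h.trans hk), C.idn_idn]

theorem topIdn_src (x : C.cell k) : C.topIdn j (C.src h x) =
    (C.catoid (h.trans_le (Fin.le_last k))).src (C.topIdn k x) := by
  rw [topIdn_of_lt (h.trans_le (Fin.le_last k))]
  obtain rfl | hk := eq_or_lt_of_le (Fin.le_last k)
  · rw [topIdn_last]; rfl
  · rw [topIdn_of_lt hk, ← C.src_idn_of_lt h hk]; rfl

theorem topIdn_tgt (x : C.cell k) : C.topIdn j (C.tgt h x) =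
    (C.catoid (h.trans_le (Fin.le_last k))).tgt (C.topIdn k x) := by
  rw [topIdn_of_lt (h.trans_le (Fin.le_last k))]
  obtain rfl | hk := eq_or_lt_of_le (Fin.le_last k)
  · rw [topIdn_last]; rfl
  · rw [topIdn_of_lt hk, ← C.tgt_idn_of_lt h hk]; rfl

theorem topIdn_comp_mem (x y : C.cell k) (hxy : C.src h x = C.tgt h y) :
    C.topIdn k (C.comp h x y hxy) ∈
      (C.catoid (h.trans_le (Fin.le_last k))).mul (C.topIdn k x) (C.topIdn k y) := by
  obtain rfl | hk := eq_or_lt_of_le (Fin.le_last k)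
  · simp only [topIdn_last]; exact ⟨hxy, rfl⟩
  · simp only [topIdn_of_lt hk]
    exact C.idn_comp_mem_catoid_mul h hk x y hxy

theorem catoid_src_topIdn (h : k < Fin.last n) (x : C.cell k) :
    (C.catoid h).src (C.topIdn k x) = C.topIdn k x := by
  rw [topIdn_of_lt h]
  simp only [catoid]
  rw [C.src_idn]

/-- Identifies the image of the `k`-cells; the condition is vacuous when `k = n`. -/
theorem topIdn_topSrc (x : C.cell (Fin.last n))
    (hx : ∀ h : k < Fin.last n, (C.catoid h).src x = x) : C.topIdn k (C.topSrc k x) = x := by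
  obtain rfl | h := eq_or_lt_of_le (Fin.le_last k)
  · simp
  · rw [topIdn_of_lt h, topSrc_of_lt h]
    exact hx h

theorem Hom.topIdn_map {D : StrictNCat.{u} n} (F : Hom C D) (x : C.cell k) :
    D.topIdn k (F.map k x) = F.map (Fin.last n) (C.topIdn k x) := by
  obtain rfl | h := eq_or_lt_of_le (Fin.le_last k)
  · simp
  · rw [topIdn_of_lt h, topIdn_of_lt h, F.map_idn]

end

/-! ### Full faithfulness -/

section

variable {C D : StrictNCat.{u} n} (f : NCatoid.Hom C.nCatoid D.nCatoid) {k : Fin (n + 1)}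

/-- The function on `n`-cells underlying a morphism of the `n`-catoids of `n`-cells. -/
def topMap : C.cell (Fin.last n) → D.cell (Fin.last n) := f.toFun

theorem topMap_catoid_src (h : k < Fin.last n) (x : C.cell (Fin.last n)) :
    topMap f ((C.catoid h).src x) = (D.catoid h).src (topMap f x) :=
  f.map_src ⟨k, h⟩ x

theorem topMap_catoid_tgt (h : k < Fin.last n) (x : C.cell (Fin.last n)) :
    topMap f ((C.catoid h).tgt x) = (D.catoid h).tgt (topMap f x) :=
  f.map_tgt ⟨k, h⟩ x

theorem topMap_mem_catoid_mul (h : k < Fin.last n)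
    {x y z : C.cell (Fin.last n)} (hz : z ∈ (C.catoid h).mul x y) :
    topMap f z ∈ (D.catoid h).mul (topMap f x) (topMap f y) :=
  f.map_mul ⟨k, h⟩ x y ⟨z, hz, rfl⟩

/-- As `f` commutes with `s_k`, it maps identities on `k`-cells to identities on `k`-cells, so
nothing is lost by descending to dimension `k`. -/
theorem topIdn_topSrc_map (x : C.cell k) :
    D.topIdn k (D.topSrc k (topMap f (C.topIdn k x))) = topMap f (C.topIdn k x) :=
  topIdn_topSrc _ fun h => by rw [← topMap_catoid_src, catoid_src_topIdn]

/-- The strict `n`-functor extending a morphism of the `n`-catoids of `n`-cells. -/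
def homOfNCatoidHom : Hom C D where
  map k x := D.topSrc k (topMap f (C.topIdn k x))
  map_src h x := topIdn_injective _ <| by
    rw [topIdn_topSrc_map, topIdn_src, topMap_catoid_src, topIdn_src, topIdn_topSrc_map]
  map_tgt h x := topIdn_injective _ <| by
    rw [topIdn_topSrc_map, topIdn_tgt, topMap_catoid_tgt, topIdn_tgt, topIdn_topSrc_map]
  map_idn h x := topIdn_injective _ <| by
    rw [topIdn_topSrc_map, topIdn_idn, topIdn_idn, topIdn_topSrc_map]
  map_comp h x y hxy hxy' := topIdn_injective _ <| by
    -- Both sides, seen as `n`-cells, lie in one product, which has at most one element.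
    have h₁ := topMap_mem_catoid_mul f _ (topIdn_comp_mem h x y hxy)
    have h₂ := topIdn_comp_mem h _ _ hxy'
    rw [topIdn_topSrc_map, topIdn_topSrc_map] at h₂
    rw [topIdn_topSrc_map]
    obtain ⟨_, h₁⟩ := h₁
    obtain ⟨_, h₂⟩ := h₂
    rw [h₁, h₂]

end

instance : (toNCatoid.{u} n).Faithful where
  map_injective {C D F G} h := by
    have h' : Hom.map F (Fin.last n) = Hom.map G (Fin.last n) :=
      congrArg (fun f => NCatoid.Hom.toFun f.hom) h
    refine Hom.ext (funext fun k => funext fun x => topIdn_injective k ?_)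
    rw [Hom.topIdn_map, Hom.topIdn_map, h']

instance : (toNCatoid.{u} n).Full where
  map_surjective {C D} f := ⟨homOfNCatoidHom f.hom, by
    apply ObjectProperty.hom_ext
    exact NCatoid.Hom.ext (funext fun x => (topSrc_last _).trans
      (congrArg (topMap f.hom) (topIdn_last x)))⟩

end StrictNCat

/-! ## The strict `n`-category of a local functional `n`-catoid -/

namespace NCatoid

variable {n : ℕ} (K : NCatoid.{u} n)

/-- The `k`-cells of an `n`-catoid are the elements fixed by `s_i` for all `i ≥ k`. -/
def Cell (k : ℕ) : Type u := {x : K.carrier // ∀ i : Fin n, k ≤ i → (K.str i).src x = x}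

variable {K} {k : ℕ}

theorem Cell.src_val (x : K.Cell k) {i : Fin n} (h : k ≤ i) : (K.str i).src x.1 = x.1 := x.2 i h

theorem Cell.tgt_val (x : K.Cell k) {i : Fin n} (h : k ≤ i) : (K.str i).tgt x.1 = x.1 :=
  Catoid.tgt_eq_self_of_src_eq_self (x.2 i h)

theorem src_src_of_le {i j : Fin n} (h : i ≤ j) (x : K.carrier) :
    (K.str j).src ((K.str i).src x) = (K.str i).src x := by
  obtain rfl | h := eq_or_lt_of_le h
  · exact Catoid.src_src_self _ x
  · exact K.src_src i j h x

theorem src_tgt_of_le {i j : Fin n} (h : i ≤ j) (x : K.carrier) :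
    (K.str j).src ((K.str i).tgt x) = (K.str i).tgt x := by
  obtain rfl | h := eq_or_lt_of_le h
  · exact Catoid.src_tgt_self _ x
  · exact K.src_tgt i j h x

/-- The closure axiom puts `s_j(z)` in `x ⊙_i y` along with `z`; functionality makes them equal. -/
theorem src_of_mem_mul_of_fixed {i j : Fin n} (h : i < j) {x y z : K.carrier}
    (hx : (K.str j).src x = x) (hy : (K.str j).src y = y) (hz : z ∈ (K.str i).mul x y)
    (hK : (K.str i).IsFunctional) : (K.str j).src z = z := by
  have hc := K.closure i j h x y
  rw [hx, hy] at hc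
  exact hK _ _ x y (hc ▸ ⟨z, hz, rfl⟩) hz

/-- The globular identities come from commuting the two maps and then absorbing the higher one. -/
theorem src_low_src_high {i j : Fin n} (h : i < j) (x : K.carrier) :
    (K.str i).src ((K.str j).src x) = (K.str i).src x := by
  rw [K.src_src_comm i j h.ne, K.src_src i j h]

theorem src_low_tgt_high {i j : Fin n} (h : i < j) (x : K.carrier) :
    (K.str i).src ((K.str j).tgt x) = (K.str i).src x := by
  rw [K.src_tgt_comm i j h.ne, K.tgt_src i j h]

theorem tgt_low_src_high {i j : Fin n} (h : i < j) (x : K.carrier) :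
    (K.str i).tgt ((K.str j).src x) = (K.str i).tgt x := by
  rw [K.tgt_src_comm i j h.ne, K.src_tgt i j h]

theorem tgt_low_tgt_high {i j : Fin n} (h : i < j) (x : K.carrier) :
    (K.str i).tgt ((K.str j).tgt x) = (K.str i).tgt x := by
  rw [K.tgt_tgt_comm i j h.ne, K.tgt_tgt i j h]

variable (hK : isLocalFunctional n K)

/-- The unique element of a non-empty product in a local functional `n`-catoid. -/
noncomputable def mulElem (i : Fin n) (x y : K.carrier)
    (h : (K.str i).src x = (K.str i).tgt y) : K.carrier :=
  (hK.1 i x y h).some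

theorem mulElem_mem (i : Fin n) {x y : K.carrier} (h : (K.str i).src x = (K.str i).tgt y) :
    mulElem hK i x y h ∈ (K.str i).mul x y :=
  (hK.1 i x y h).some_mem

theorem eq_mulElem {i : Fin n} {x y z : K.carrier} (hz : z ∈ (K.str i).mul x y)
    (h : (K.str i).src x = (K.str i).tgt y) : z = mulElem hK i x y h :=
  hK.2 i _ _ x y hz (mulElem_mem hK i h)

/-- The index of composition along `j`-cells, where `j < k ≤ n`. -/
abbrev dim {j k : Fin (n + 1)} (h : j < k) : Fin n := ⟨j, h.trans_le (Fin.le_last k)⟩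

/-- The strict `n`-category of a local functional `n`-catoid. -/
noncomputable def strictNCat : StrictNCat.{u} n where
  cell k := K.Cell k
  src {j k} h x := ⟨(K.str (dim h)).src x.1, fun i hi => K.src_src_of_le (i := dim h) hi _⟩
  tgt {j k} h x := ⟨(K.str (dim h)).tgt x.1, fun i hi => K.src_tgt_of_le (i := dim h) hi _⟩
  idn {j k} h x := ⟨x.1, fun i hi => x.2 i ((Fin.lt_def.1 h).le.trans hi)⟩
  comp {j k} h x y hxy := ⟨mulElem hK (dim h) x.1 y.1 (congrArg Subtype.val hxy), fun i hi =>
    src_of_mem_mul_of_fixed (i := dim h) (j := i) ((Fin.lt_def.1 h).trans_le hi)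
      (x.2 i hi) (y.2 i hi) (mulElem_mem hK _ (congrArg Subtype.val hxy)) (hK.2 _)⟩
  src_src hij hjk x := Subtype.ext (src_low_src_high (j := dim hjk) hij _)
  src_tgt hij hjk x := Subtype.ext (src_low_tgt_high (j := dim hjk) hij _)
  tgt_src hij hjk x := Subtype.ext (tgt_low_src_high (j := dim hjk) hij _)
  tgt_tgt hij hjk x := Subtype.ext (tgt_low_tgt_high (j := dim hjk) hij _)
  idn_idn _ _ _ := rfl
  src_idn h x := Subtype.ext (x.src_val le_rfl)
  tgt_idn h x := Subtype.ext (x.tgt_val le_rfl)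
  src_comp h x y hxy := Subtype.ext
    (Catoid.src_of_mem_mul (mulElem_mem hK _ (congrArg Subtype.val hxy)))
  tgt_comp h x y hxy := Subtype.ext
    (Catoid.tgt_of_mem_mul (mulElem_mem hK _ (congrArg Subtype.val hxy)))
  -- The axiom places the `j`-source of the composite in the product of the `j`-sources, whose only
  -- element is their composite.
  comp_src {i j k} hij hjk x y hxy hs := Subtype.ext <| eq_mulElem hK
    (K.src_mul_subset (dim hjk) (dim hij) (Fin.ne_of_gt hij) _ _
      ⟨_, mulElem_mem hK _ (congrArg Subtype.val hxy), rfl⟩) (congrArg Subtype.val hs)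
  comp_tgt {i j k} hij hjk x y hxy hs := Subtype.ext <| eq_mulElem hK
    (K.tgt_mul_subset (dim hjk) (dim hij) (Fin.ne_of_gt hij) _ _
      ⟨_, mulElem_mem hK _ (congrArg Subtype.val hxy), rfl⟩) (congrArg Subtype.val hs)
  idn_tgt_comp h x := Subtype.ext <| Eq.symm <| eq_mulElem hK
    (by rw [Catoid.tgt_mul]; rfl) (Catoid.src_tgt_self _ _)
  comp_idn_src h x := Subtype.ext <| Eq.symm <| eq_mulElem hK
    (by rw [Catoid.mul_src]; rfl) (Catoid.tgt_src_self _ _).symm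
  assoc {j k} h x y z hxy hyz h₁ h₂ := Subtype.ext <| by
    -- Associativity of sets yields some `v` in `y ⊙ z` with the composite in `x ⊙ v`; functionality
    -- forces `v` to be the composite of `y` and `z`.
    have hm : mulElem hK (dim h) _ z.1 (congrArg Subtype.val h₁) ∈
        ⋃ w ∈ (K.str (dim h)).mul x.1 y.1, (K.str (dim h)).mul w z.1 :=
      Set.mem_biUnion (mulElem_mem hK _ (congrArg Subtype.val hxy))
        (mulElem_mem hK _ (congrArg Subtype.val h₁))
    rw [← Catoid.assoc] at hm
    obtain ⟨v, hv, hm⟩ := Set.mem_iUnion₂.1 hm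
    obtain rfl := eq_mulElem hK hv (congrArg Subtype.val hyz)
    exact eq_mulElem hK hm (congrArg Subtype.val h₂)
  -- Identities leave the underlying element unchanged, and composition along `i` uses `⊙_i`
  -- whatever the dimension of the cells.
  idn_comp _ _ _ _ _ _ := rfl
  interchange {i j k} hij hjk w x y z hwx hyz hwy hxz h₁ h₂ := Subtype.ext <| by
    have hm := K.interchange (dim hij) (dim hjk) hij w.1 x.1 y.1 z.1
      (Set.mem_biUnion (mulElem_mem hK _ (congrArg Subtype.val hwx))
        (Set.mem_biUnion (mulElem_mem hK _ (congrArg Subtype.val hyz))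
          (mulElem_mem hK _ (congrArg Subtype.val h₁))))
    simp only [Catoid.setMul, Set.mem_iUnion] at hm
    obtain ⟨a, ha, b, hb, hm⟩ := hm
    obtain rfl := eq_mulElem hK ha (congrArg Subtype.val hwy)
    obtain rfl := eq_mulElem hK hb (congrArg Subtype.val hxz)
    exact eq_mulElem hK hm (congrArg Subtype.val h₂)

/-- A local functional `n`-catoid is isomorphic to that of the `n`-cells of its strict
`n`-category. -/
noncomputable def isoNCatoid (K : LocalFunctionalNCatoid.{u} n) :
    (StrictNCat.toNCatoid n).obj (strictNCat K.2) ≅ K where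
  hom := ObjectProperty.homMk
    { toFun := fun x : K.obj.Cell (Fin.last n) => x.1
      map_src := fun _ _ => rfl
      map_tgt := fun _ _ => rfl
      map_mul := by
        rintro i x y _ ⟨_, ⟨h, rfl⟩, rfl⟩
        exact mulElem_mem K.2 i (congrArg Subtype.val h) }
  inv := ObjectProperty.homMk
    -- No index `i < n` satisfies `n ≤ i`, so every element is an `n`-cell.
    { toFun := fun x => (⟨x, fun i hi => absurd i.2 (not_lt.2 hi)⟩ : K.obj.Cell (Fin.last n))
      map_src := fun _ _ => rfl
      map_tgt := fun _ _ => rfl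
      map_mul := by
        rintro i x y _ ⟨z, hz, rfl⟩
        exact ⟨Subtype.ext ((K.obj.str i).src_eq_tgt x y ⟨z, hz⟩),
          Subtype.ext (eq_mulElem K.2 hz ((K.obj.str i).src_eq_tgt x y ⟨z, hz⟩))⟩ }
  hom_inv_id := rfl
  inv_hom_id := rfl

end NCatoid

namespace StrictNCat

instance (n : ℕ) : (toNCatoid.{u} n).EssSurj where
  mem_essImage K := ⟨_, ⟨NCatoid.isoNCatoid K⟩⟩

instance (n : ℕ) : (toNCatoid.{u} n).IsEquivalence where

end StrictNCat

/-- The category of strict `n`-categories is equivalent to the category of local functional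
`n`-catoids, by an equivalence that sends a strict `n`-category `C` (up to a bijection `φ C`,
natural in `C`) to its set of `n`-cells, with `s_i`, `t_i` given by the identity `n`-cells on the
`i`-dimensional source and target, and with `x ⊙_i y` being `{x ∘_i y}` if `x ∘_i y` is defined
and `∅` otherwise. -/
theorem mainTheorem2 (n : ℕ) :
    ∃ (e : StrictNCat.{u} n ≌ LocalFunctionalNCatoid.{u} n)
      (φ : ∀ C : StrictNCat.{u} n, C.cell (Fin.last n) ≃ (e.functor.obj C).obj.carrier),
      (∀ (C D : StrictNCat.{u} n) (F : C ⟶ D) (x : C.cell (Fin.last n)),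
        φ D (StrictNCat.onCells F (Fin.last n) x) = NCatoid.fn (e.functor.map F).hom (φ C x)) ∧
      ∀ (C : StrictNCat.{u} n) (i : Fin n),
        (∀ x, ((e.functor.obj C).obj.str i).src (φ C x) =
          φ C (C.idn (Fin.castSucc_lt_last i) (C.src (Fin.castSucc_lt_last i) x))) ∧
        (∀ x, ((e.functor.obj C).obj.str i).tgt (φ C x) =
          φ C (C.idn (Fin.castSucc_lt_last i) (C.tgt (Fin.castSucc_lt_last i) x))) ∧
        (∀ x y, ((e.functor.obj C).obj.str i).mul (φ C x) (φ C y) =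
          {z | ∃ h : C.src (Fin.castSucc_lt_last i) x = C.tgt (Fin.castSucc_lt_last i) y,
            z = φ C (C.comp (Fin.castSucc_lt_last i) x y h)}) :=
  -- The carrier is the set of `n`-cells by definition, so the identity serves as the natural
  -- bijection.
  ⟨(StrictNCat.toNCatoid n).asEquivalence, fun _ => Equiv.refl _, fun _ _ _ _ => rfl,
    fun _ _ => ⟨fun _ => rfl, fun _ => rfl, fun _ _ => rfl⟩⟩
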